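/- Let $E=E_8(-1)^{\oplus 2}$, let $U_1,U_2,U_3$ be copies of the hyperbolic plane with isotropic standard bases $e_i,f_i$, $(e_i.f_i)=1$, and let $U_4$ have isotropic basis $e_4,f_4$ with $(e_4.f_4)=-1$. Consider the lattices $$\Gamma=E\oplus U_1\oplus U_2\oplus A_2(-1),\qquad \bar\Gamma=E\oplus U_1\oplus U_2\oplus \mathrm{I}_{0,3},\qquad \tilde\Lambda=E\oplus U_1\oplus U_2\oplus U_3\oplus U_4 .$$ Let $\mu_1,\mu_2$ be the basis of $A_2(-1)$ with $(\mu_i)^2=-2$, $(\mu_1.\mu_2)=1$. Put $h^2=(1,1,1)\in \mathrm{I}_{0,3}$ and embed $\Gamma=(h^2)^\perp\subset\bar\Gamma$ by $\mu_1\mapsto(1,-1,0)$, $\mu_2\mapsto(0,1,-1)$. Put $\lambda_1=e_4-f_4$, $\lambda_2=e_3+f_3+f_4$, $A_2=\mathbb{Z}\lambda_1\oplus\mathbb{Z}\lambda_2\subset\tilde\Lambda$, and identify $\Gamma$ with $A_2^\perp\subset\tilde\Lambda$ by $\mu_1\mapsto e_3-f_3$, $\mu_2\mapsto -e_3-e_4-f_4$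 (both embeddings being the identity on $E\oplus U_1\oplus U_2$). For $v\in\Gamma$ let $K_v\subset\bar\Gamma$ be the saturation of $\mathbb{Z}h^2+\mathbb{Z}v$ and $L_v\subset\tilde\Lambda$ the saturation of $A_2+\mathbb{Z}v$. Let $\mathrm{disc}$ denote the absolute value of the determinant of a Gram matrix, and let $\tilde{\mathrm O}(\Gamma)=\{g\in \mathrm O(\bar\Gamma)\mid g(h^2)=h^2\}$, which acts on $\Gamma=(h^2)^\perp$. **Proposition (Hassett).** Let $v,v'\in\Gamma$ be primitive. Then $\mathrm{disc}(L_v)=\mathrm{disc}(L_{v'})$ if and only if $\mathrm{disc}(K_v)=\mathrm{disc}(K_{v'})$. If these equalities hold and $(v)^2,(v')^2$ are either both negative or both non-negative, then there exists $g\in\tilde{\mathrm O}(\Gamma)$ such that $g(v)=v'$ or $g(v)=-v'$, and there are isometries $L_{v'}\cong L_{g(v)}$ and $K_{v'}\cong K_{g(v)}$, as well as $L_v\cong L_{v'}$ and $K_v\cong K_{v'}$. -/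

import Mathlib

namespace CubicLattice

open LinearMap (BilinForm)

/-! ### General lattice notions -/

section General

variable {M N : Type*} [AddCommGroup M] [AddCommGroup N]

/-- The orthogonal direct sum of two bilinear forms. -/
def orthSum (B : BilinForm ℤ M) (B' : BilinForm ℤ N) : BilinForm ℤ (M × N) :=
  B.compl₁₂ (LinearMap.fst ℤ M N) (LinearMap.fst ℤ M N) +
    B'.compl₁₂ (LinearMap.snd ℤ M N) (LinearMap.snd ℤ M N)

@[simp]
theorem orthSum_apply (B : BilinForm ℤ M) (B' : BilinForm ℤ N) (x y : M × N) :
    orthSum B B' x y = B x.1 y.1 + B' x.2 y.2 := rfl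

/-- A vector is primitive if it is only divisible by `1` and `-1`. In a torsion-free group this
excludes `0`. -/
def IsPrimitiveVector (v : M) : Prop :=
  ∀ (n : ℤ) (w : M), v = n • w → IsUnit n

/-- The saturation of a subgroup `S`: all `x` with a nonzero integral multiple in `S`. -/
def saturation (S : Submodule ℤ M) : Submodule ℤ M where
  carrier := {x | ∃ n : ℤ, n ≠ 0 ∧ n • x ∈ S}
  zero_mem' := ⟨1, one_ne_zero, by simp⟩
  add_mem' := by
    rintro x y ⟨m, hm, hx⟩ ⟨n, hn, hy⟩
    refine ⟨m * n, mul_ne_zero hm hn, ?_⟩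
    rw [smul_add]
    refine S.add_mem ?_ ?_
    · rw [mul_comm, mul_smul]
      exact S.smul_mem n hx
    · rw [mul_smul]
      exact S.smul_mem m hy
  smul_mem' := by
    rintro c x ⟨n, hn, hx⟩
    refine ⟨n, hn, ?_⟩
    rw [smul_comm]
    exact S.smul_mem c hx

/-- The discriminant (in absolute value) of an integral bilinear form on a free module of finite
rank: the absolute value of the determinant of a Gram matrix. -/
noncomputable def disc [Module.Free ℤ M] [Module.Finite ℤ M] (B : BilinForm ℤ M) : ℕ :=
  ((LinearMap.BilinForm.toMatrix (Module.Free.chooseBasis ℤ M) B).det).natAbs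

/-- The discriminant can be computed in any basis. -/
theorem disc_eq [Module.Free ℤ M] [Module.Finite ℤ M] (B : BilinForm ℤ M)
    {ι : Type*} [Fintype ι] [DecidableEq ι] (b : Module.Basis ι ℤ M) :
    disc B = ((LinearMap.BilinForm.toMatrix b B).det).natAbs := by
  classical
  set c := Module.Free.chooseBasis ℤ M with hc
  let e := c.indexEquiv b
  have h1 : ((LinearMap.BilinForm.toMatrix (c.reindex e) B).det) = (LinearMap.BilinForm.toMatrix c B).det := by
    have : LinearMap.BilinForm.toMatrix (c.reindex e) B = (LinearMap.BilinForm.toMatrix c B).submatrix e.symm e.symm := by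
      ext i j
      simp [LinearMap.BilinForm.toMatrix_apply]
    rw [this, Matrix.det_submatrix_equiv_self]
  have h2 := LinearMap.BilinForm.toMatrix_mul_basis_toMatrix (c.reindex e) b B
  have h3 : IsUnit ((c.reindex e).toMatrix b).det := by
    have := Module.Basis.invertibleToMatrix (c.reindex e) b
    exact (Matrix.isUnit_iff_isUnit_det _).1 (isUnit_of_invertible _)
  rw [disc, ← hc, ← h1, ← h2, Matrix.det_mul, Matrix.det_mul, Matrix.det_transpose,
    Int.natAbs_mul, Int.natAbs_mul, Int.isUnit_iff_natAbs_eq.1 h3]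
  simp

end General

/-! ### The lattices -/

/-- The underlying group of `E ⊕ U₁ ⊕ U₂`, where `E = E₈(-1) ⊕ E₈(-1)`. -/
abbrev Common : Type := ((Fin 8 → ℤ) × (Fin 8 → ℤ)) × ((Fin 2 → ℤ) × (Fin 2 → ℤ))

/-- The lattice `E₈(-1)`. -/
def formE8Neg : BilinForm ℤ (Fin 8 → ℤ) := Matrix.toBilin' (-CartanMatrix.E₈)

/-- The hyperbolic plane `U`: isotropic `e = (1,0)`, `f = (0,1)` with `(e.f) = 1`. -/
def formU : BilinForm ℤ (Fin 2 → ℤ) := Matrix.toBilin' !![0, 1; 1, 0]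

/-- The lattice `U₄`: isotropic `e₄ = (1,0)`, `f₄ = (0,1)` with `(e₄.f₄) = -1`. -/
def formU4 : BilinForm ℤ (Fin 2 → ℤ) := Matrix.toBilin' !![0, -1; -1, 0]

/-- The lattice `A₂(-1)`, with basis `μ₁ = (1,0)`, `μ₂ = (0,1)`. -/
def formA2Neg : BilinForm ℤ (Fin 2 → ℤ) := Matrix.toBilin' !![-2, 1; 1, -2]

/-- The lattice `I_{0,3}`. -/
def formI03 : BilinForm ℤ (Fin 3 → ℤ) := Matrix.toBilin' (-1)

/-- The lattice `E ⊕ U₁ ⊕ U₂`. -/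
def formCommon : BilinForm ℤ Common :=
  orthSum (orthSum formE8Neg formE8Neg) (orthSum formU formU)

/-- The underlying group of `Γ = E ⊕ U₁ ⊕ U₂ ⊕ A₂(-1)`. -/
abbrev Gamma : Type := Common × (Fin 2 → ℤ)

/-- The primitive cubic lattice `Γ = E ⊕ U₁ ⊕ U₂ ⊕ A₂(-1)`. -/
def formGamma : BilinForm ℤ Gamma := orthSum formCommon formA2Neg

/-- The underlying group of `Γ̄ = E ⊕ U₁ ⊕ U₂ ⊕ I_{0,3}`. -/
abbrev GammaBar : Type := Common × (Fin 3 → ℤ)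

/-- The cubic lattice `Γ̄ = E ⊕ U₁ ⊕ U₂ ⊕ I_{0,3}`. -/
def formGammaBar : BilinForm ℤ GammaBar := orthSum formCommon formI03

/-- The underlying group of `Λ̃ = E ⊕ U₁ ⊕ U₂ ⊕ U₃ ⊕ U₄`. -/
abbrev Mukai : Type := Common × ((Fin 2 → ℤ) × (Fin 2 → ℤ))

/-- The Mukai lattice `Λ̃ = E ⊕ U₁ ⊕ U₂ ⊕ U₃ ⊕ U₄`. -/
def formMukai : BilinForm ℤ Mukai := orthSum formCommon (orthSum formU formU4)

/-- The class `h² = (1,1,1) ∈ I_{0,3} ⊆ Γ̄`. -/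
def hSq : GammaBar := (0, ![1, 1, 1])

/-- `λ₁ = e₄ - f₄`. -/
def lam1 : Mukai := (0, (![0, 0], ![1, -1]))

/-- `λ₂ = e₃ + f₃ + f₄`. -/
def lam2 : Mukai := (0, (![1, 1], ![0, 1]))

/-- The embedding `Γ ⊆ Γ̄`: the identity on `E ⊕ U₁ ⊕ U₂`, and on `A₂(-1)` given by
`μ₁ ↦ (1,-1,0)`, `μ₂ ↦ (0,1,-1)`. -/
def toGammaBar : Gamma →ₗ[ℤ] GammaBar :=
  LinearMap.prodMap LinearMap.id
    (Fintype.linearCombination ℤ ![![1, -1, 0], ![0, 1, -1]])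

/-- The embedding `Γ ≅ A₂^⊥ ⊆ Λ̃`: the identity on `E ⊕ U₁ ⊕ U₂`, and on `A₂(-1)` given by
`μ₁ ↦ e₃ - f₃`, `μ₂ ↦ -e₃ - e₄ - f₄`. -/
def toMukai : Gamma →ₗ[ℤ] Mukai :=
  LinearMap.prodMap LinearMap.id
    (Fintype.linearCombination ℤ ![(![1, -1], ![0, 0]), (![-1, 0], ![-1, -1])])

theorem toGammaBar_apply (x : Gamma) :
    toGammaBar x = (x.1, ![x.2 0, x.2 1 - x.2 0, -x.2 1]) := by
  refine Prod.ext rfl ?_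
  funext i
  fin_cases i <;> simp [toGammaBar, Fintype.linearCombination_apply, Fin.sum_univ_two] <;> ring

theorem toMukai_apply (x : Gamma) :
    toMukai x = (x.1, (![x.2 0 - x.2 1, -x.2 0], ![-x.2 1, -x.2 1])) := by
  refine Prod.ext rfl (Prod.ext ?_ ?_) <;> funext i <;>
  fin_cases i <;> simp [toMukai, Fintype.linearCombination_apply, Fin.sum_univ_two] <;> ring

theorem toGammaBar_isometry (x y : Gamma) :
    formGammaBar (toGammaBar x) (toGammaBar y) = formGamma x y := by
  simp only [toGammaBar_apply, formGammaBar, formGamma, orthSum_apply, formI03, formA2Neg,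
    Matrix.toBilin'_apply, Fin.sum_univ_two, Fin.sum_univ_three]
  simp
  ring

theorem toMukai_isometry (x y : Gamma) :
    formMukai (toMukai x) (toMukai y) = formGamma x y := by
  simp only [toMukai_apply, formMukai, formGamma, orthSum_apply, formU, formU4, formA2Neg,
    Matrix.toBilin'_apply, Fin.sum_univ_two]
  simp
  ring

theorem toGammaBar_injective : Function.Injective toGammaBar := by
  intro x y h
  rw [toGammaBar_apply, toGammaBar_apply, Prod.mk.injEq] at h
  have h0 := congrFun h.2 0
  have h2 := congrFun h.2 2
  simp at h0 h2
  refine Prod.ext h.1 ?_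
  funext i
  fin_cases i
  · exact h0
  · exact h2

theorem formGammaBar_hSq (y : GammaBar) :
    formGammaBar hSq y = -(y.2 0 + y.2 1 + y.2 2) := by
  simp [formGammaBar, hSq, formI03, Matrix.toBilin'_apply, Fin.sum_univ_three, Matrix.one_apply]


/-- `Γ` is the orthogonal complement of `h²` in `Γ̄`. -/
theorem mem_range_toGammaBar (y : GammaBar) :
    y ∈ LinearMap.range toGammaBar ↔ formGammaBar hSq y = 0 := by
  rw [formGammaBar_hSq]
  constructor
  · rintro ⟨x, rfl⟩
    rw [toGammaBar_apply]
    simp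
  · intro h
    refine ⟨(y.1, ![y.2 0, -y.2 2]), ?_⟩
    rw [toGammaBar_apply]
    refine Prod.ext rfl ?_
    funext i
    fin_cases i <;> simp
    linarith

/-- `Γ` is the orthogonal complement of `A₂ = ℤλ₁ ⊕ ℤλ₂` in `Λ̃`. -/
theorem mem_range_toMukai (y : Mukai) :
    y ∈ LinearMap.range toMukai ↔ formMukai lam1 y = 0 ∧ formMukai lam2 y = 0 := by
  have e1 : formMukai lam1 y = y.2.2 0 - y.2.2 1 := by
    simp [formMukai, lam1, formU, formU4, Matrix.toBilin'_apply, Fin.sum_univ_two]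
    ring
  have e2 : formMukai lam2 y = y.2.1 0 + y.2.1 1 - y.2.2 0 := by
    simp [formMukai, lam2, formU, formU4, Matrix.toBilin'_apply, Fin.sum_univ_two]
    ring
  rw [e1, e2]
  constructor
  · rintro ⟨x, rfl⟩
    rw [toMukai_apply]
    simp
    ring
  · rintro ⟨h1, h2⟩
    refine ⟨(y.1, ![-y.2.1 1, -y.2.2 0]), ?_⟩
    rw [toMukai_apply]
    refine Prod.ext rfl (Prod.ext ?_ ?_) <;> funext i <;> fin_cases i <;> simp <;> linarith

/-- `K_v ⊆ Γ̄`: the saturation of `ℤh² ⊕ ℤv`. -/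
def K (v : Gamma) : Submodule ℤ GammaBar :=
  saturation (Submodule.span ℤ {hSq, toGammaBar v})

/-- `L_v ⊆ Λ̃`: the saturation of `A₂ ⊕ ℤv`. -/
def L (v : Gamma) : Submodule ℤ Mukai :=
  saturation (Submodule.span ℤ {lam1, lam2, toMukai v})

/-- The intersection form on `K_v`. -/
def formK (v : Gamma) : BilinForm ℤ (K v) := formGammaBar.restrict (K v)

/-- The intersection form on `L_v`. -/
def formL (v : Gamma) : BilinForm ℤ (L v) := formMukai.restrict (L v)

/-! ### The group `Õ(Γ)` -/

/-- The group `Õ(Γ) = {g ∈ O(Γ̄) | g(h²) = h²}`. -/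
def OTilde : Subgroup (GammaBar ≃ₗ[ℤ] GammaBar) where
  carrier := {g | (∀ x y, formGammaBar (g x) (g y) = formGammaBar x y) ∧ g hSq = hSq}
  one_mem' := ⟨fun _ _ => rfl, rfl⟩
  mul_mem' := by
    rintro g g' ⟨h1, h2⟩ ⟨h1', h2'⟩
    refine ⟨fun x y => ?_, ?_⟩
    · rw [LinearEquiv.mul_apply, LinearEquiv.mul_apply, h1, h1']
    · rw [LinearEquiv.mul_apply, h2', h2]
  inv_mem' := by
    rintro g ⟨h1, h2⟩
    refine ⟨fun x y => ?_, ?_⟩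
    · rw [← h1 (g⁻¹ x) (g⁻¹ y)]
      simp only [← LinearEquiv.mul_apply, mul_inv_cancel, LinearEquiv.coe_one, id_eq]
    · conv_lhs => rw [← h2]
      simp only [← LinearEquiv.mul_apply, inv_mul_cancel, LinearEquiv.coe_one, id_eq]

theorem map_mem_range (g : OTilde) (x : Gamma) :
    g.1 (toGammaBar x) ∈ LinearMap.range toGammaBar := by
  rw [mem_range_toGammaBar]
  have h := g.2.1 hSq (toGammaBar x)
  rw [g.2.2] at h
  rw [h]
  exact (mem_range_toGammaBar _).1 ⟨x, rfl⟩

/-- The action of `g ∈ Õ(Γ)` on `Γ = (h²)^⊥`, obtained by restriction from `Γ̄`. -/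
noncomputable def act (g : OTilde) : Gamma →ₗ[ℤ] Gamma :=
  (LinearEquiv.ofInjective toGammaBar toGammaBar_injective).symm.toLinearMap ∘ₗ
    LinearMap.codRestrict (LinearMap.range toGammaBar) (g.1.toLinearMap ∘ₗ toGammaBar)
      (map_mem_range g)

/-- The action on `Γ` is the restriction of the action on `Γ̄`. -/
theorem toGammaBar_act (g : OTilde) (x : Gamma) :
    toGammaBar (act g x) = g.1 (toGammaBar x) := by
  have h := LinearEquiv.apply_symm_apply
    (LinearEquiv.ofInjective toGammaBar toGammaBar_injective)
    (LinearMap.codRestrict (LinearMap.range toGammaBar) (g.1.toLinearMap ∘ₗ toGammaBar)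
      (map_mem_range g) x)
  exact congrArg Subtype.val h

end CubicLattice

/-!
The proof brings a primitive vector of `Γ` into a normal form by isometries that extend both to
`Γ̄`, fixing `h²`, and to `Λ̃`, fixing `λ₁` and `λ₂` (`OrbitRel`). Two kinds of isometries suffice:
those of `E ⊕ U₁ ⊕ U₂`, extended by the identity, and Eichler transvections
`x ↦ x - (a.x)e + (e.x)a - ½(a.a)(e.x)e` with `e, a ∈ Γ`, whose defining formula makes sense in every
lattice containing `Γ` and fixes `Γ^⊥`.

A Euclidean descent makes a vector `v` orthogonal to `U₂` (`exists_orbitRel_U2_eq_zero`). As `E ⊕ U₁`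
is unimodular and `A₂(-1)` has discriminant group `ℤ/3`, the pairings of `v` with `Γ` form `γℤ` with
`γ = 1` or `γ = 3` (`divisibility`). Two transvections then move `v` to `γ e₂ + t f₂ + ρ`, where `ρ`
is a representative in `A₂(-1)` of `v` modulo `γΓ` (`orbitRel_normalForm`): one may take `ρ = 0` if
`γ = 1`, and `ρ = ±(μ₁ - μ₂)` with `3 ∣ t` if `γ = 3`. Thus, up to sign, `v` is related to
`e₂ + t f₂` or to `3e₂ + 3s f₂ + μ₁ - μ₂` (`exists_normalForm`).

For these vectors explicit bases of the saturations `K_v` and `L_v` give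
`disc K_v = disc L_v = |6t|`, respectively `|6s - 2|`, while `(v)²` is `2t`, respectively `18s - 6`
(`exists_invariants`). Hence the two discriminants always agree, and together with the sign of
`(v)²` they determine the normal form, because `6t` and `±(6s - 2)` are distinct modulo `6`.
-/

namespace CubicLattice

open LinearMap (BilinForm)

/-! ### Isometries, saturations and discriminants -/

section General

variable {M N : Type*} [AddCommGroup M] [AddCommGroup N]

/-- An isometry of the ambient lattices carrying `S` onto `S'` restricts to their saturations. -/
theorem exists_saturation_isometryEquiv {B : BilinForm ℤ M} (φ : M ≃ₗ[ℤ] M)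
    (hφ : ∀ x y, B (φ x) (φ y) = B x y) {S S' : Submodule ℤ M}
    (hS : S.map (φ : M →ₗ[ℤ] M) = S') :
    Nonempty ((B.restrict (saturation S)).IsometryEquiv (B.restrict (saturation S'))) := by
  have hmap : (saturation S).map (φ : M →ₗ[ℤ] M) = saturation S' := by
    subst hS
    ext y
    constructor
    · rintro ⟨x, ⟨n, hn, hx⟩, rfl⟩
      exact ⟨n, hn, n • x, hx, by simp⟩
    · rintro ⟨n, hn, x, hx, hxy⟩
      refine ⟨φ.symm y, ⟨n, hn, ?_⟩, by simp⟩
      have : n • φ.symm y = x := φ.injective (by rw [map_smul, φ.apply_symm_apply]; exact hxy.symm)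
      exact this ▸ hx
  rw [← hmap]
  exact ⟨{ φ.submoduleMap (saturation S) with map_app' := fun x y => hφ x y }⟩

theorem disc_eq_of_isometryEquiv [Module.Free ℤ M] [Module.Finite ℤ M] [Module.Free ℤ N]
    [Module.Finite ℤ N] {B : BilinForm ℤ M} {B' : BilinForm ℤ N} (φ : B.IsometryEquiv B') :
    disc B = disc B' := by
  rw [disc, disc_eq B' ((Module.Free.chooseBasis ℤ M).map φ.toLinearEquiv)]
  congr 2
  ext i j
  simp only [LinearMap.BilinForm.toMatrix_apply, Module.Basis.map_apply]
  exact (φ.map_app' _ _).symm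

/-- If vectors `b i` have a dual family of integral functionals on the ambient group, then they
form a basis of the saturation of their span; hence they compute its discriminant. -/
theorem disc_saturation [IsAddTorsionFree M] {ι : Type*} [Fintype ι] [DecidableEq ι]
    (B : BilinForm ℤ M) (S : Submodule ℤ M) [Module.Free ℤ (saturation S)]
    [Module.Finite ℤ (saturation S)] (b : ι → M) (f : M →ₗ[ℤ] ι → ℤ)
    (hf : ∀ i, f (b i) = Pi.single i 1) (hb : ∀ i, b i ∈ saturation S)
    (hS : S ≤ Submodule.span ℤ (Set.range b)) :
    disc (B.restrict (saturation S)) = (Matrix.of fun i j => B (b i) (b j)).det.natAbs := by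
  set g : (ι → ℤ) →ₗ[ℤ] M := Fintype.linearCombination ℤ b with hg
  have hfg : ∀ c, f (g c) = c := by
    intro c
    simp only [hg, Fintype.linearCombination_apply, map_sum, map_smul, hf]
    ext j
    simp [Finset.sum_apply, Pi.single_apply]
  have hgf : ∀ x ∈ saturation S, g (f x) = x := by
    rintro x ⟨n, hn, hx⟩
    have := hS hx
    rw [← Fintype.range_linearCombination ℤ b] at this
    obtain ⟨c, hc⟩ := this
    have hc' : n • f x = c := by rw [← map_smul, ← hc]; exact hfg c
    have : n • g (f x) = n • x := by rw [← map_smul, hc']; exact hc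
    exact zsmul_right_injective hn this
  have hmem : ∀ c, g c ∈ saturation S := fun c => by
    rw [hg, Fintype.linearCombination_apply]
    exact Submodule.sum_mem _ fun i _ => Submodule.smul_mem _ _ (hb i)
  let e : (saturation S) ≃ₗ[ℤ] (ι → ℤ) :=
    { toFun := fun x => f x
      map_add' := fun x y => by simp
      map_smul' := fun c x => by simp
      invFun := fun c => ⟨g c, hmem c⟩
      left_inv := fun x => Subtype.ext (hgf x x.2)
      right_inv := fun c => hfg c }
  rw [disc_eq _ (Module.Basis.ofEquivFun e)]
  congr 2
  ext i j
  have he : ∀ i, ((Module.Basis.ofEquivFun e i : saturation S) : M) = b i := fun i => by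
    rw [Module.Basis.coe_ofEquivFun]
    change g (Pi.single i 1) = b i
    simp [hg]
  rw [LinearMap.BilinForm.toMatrix_apply, Matrix.of_apply, ← he i, ← he j]
  rfl

end General

/-! ### Eichler transvections -/

section Eichler

variable {M N : Type*} [AddCommGroup M] [AddCommGroup N]

/-- The linear map `x ↦ x - (a.x)e + (e.x)a - q(e.x)e`. If `e` is isotropic, `(e.a) = 0` and
`(a.a) = 2q`, this is the Eichler transvection attached to `e` and `a`. -/
def eichler (B : BilinForm ℤ M) (e a : M) (q : ℤ) : M →ₗ[ℤ] M :=
  LinearMap.id - (B a).smulRight e + (B e).smulRight a - q • (B e).smulRight e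

theorem eichler_apply (B : BilinForm ℤ M) (e a : M) (q : ℤ) (x : M) :
    eichler B e a q x = x - B a x • e + B e x • a - (q * B e x) • e := by
  simp [eichler, mul_smul, smul_comm q]

theorem eichler_isometry {B : BilinForm ℤ M} (hB : B.IsSymm) {e a : M} {q : ℤ}
    (he : B e e = 0) (hea : B e a = 0) (haa : B a a = 2 * q) (x y : M) :
    B (eichler B e a q x) (eichler B e a q y) = B x y := by
  have hae : B a e = 0 := by rw [hB.eq, hea]
  simp only [eichler_apply, map_sub, map_add, map_smul, LinearMap.sub_apply, LinearMap.add_apply,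
    LinearMap.smul_apply, smul_eq_mul, he, hea, hae, haa, hB.eq x e, hB.eq x a]
  ring

theorem eichler_eichler_neg {B : BilinForm ℤ M} (hB : B.IsSymm) {e a : M} {q : ℤ}
    (he : B e e = 0) (hea : B e a = 0) (haa : B a a = 2 * q) (x : M) :
    eichler B e a q (eichler B e (-a) q x) = x := by
  have hae : B a e = 0 := by rw [hB.eq, hea]
  simp only [eichler_apply, map_sub, map_add, map_smul, map_neg, LinearMap.neg_apply, he,
    hea, hae, haa]
  module

/-- The Eichler transvection as an automorphism. -/
def eichlerEquiv {B : BilinForm ℤ M} (hB : B.IsSymm) {e a : M} {q : ℤ}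
    (he : B e e = 0) (hea : B e a = 0) (haa : B a a = 2 * q) : M ≃ₗ[ℤ] M :=
  LinearEquiv.ofLinearMap (eichler B e a q) (eichler B e (-a) q)
    (LinearMap.ext fun x => eichler_eichler_neg hB he hea haa x)
    (LinearMap.ext fun x => by
      simpa using eichler_eichler_neg hB he (a := -a) (q := q) (by simp [hea]) (by simp [haa]) x)

theorem eichler_map {B : BilinForm ℤ M} {B' : BilinForm ℤ N} (i : M →ₗ[ℤ] N)
    (hi : ∀ x y, B' (i x) (i y) = B x y) (e a : M) (q : ℤ) (x : M) :
    eichler B' (i e) (i a) q (i x) = i (eichler B e a q x) := by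
  simp [eichler_apply, hi]

theorem eichler_fixed {B : BilinForm ℤ M} {e a h : M} {q : ℤ} (h1 : B e h = 0) (h2 : B a h = 0) :
    eichler B e a q h = h := by
  simp [eichler_apply, h1, h2]

end Eichler

/-! ### Parity and unimodularity -/

theorem orthSum_isSymm {M N : Type*} [AddCommGroup M] [AddCommGroup N] {B : BilinForm ℤ M}
    {B' : BilinForm ℤ N} (h : B.IsSymm) (h' : B'.IsSymm) : (orthSum B B').IsSymm :=
  ⟨fun x y => by rw [orthSum_apply, orthSum_apply, h.eq, h'.eq]⟩

theorem toBilin'_isSymm {n : Type*} [Fintype n] [DecidableEq n] {A : Matrix n n ℤ}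
    (h : A.IsSymm) : (Matrix.toBilin' A).IsSymm := by
  refine ⟨fun x y => ?_⟩
  rw [Matrix.toBilin'_apply, Matrix.toBilin'_apply, Finset.sum_comm]
  refine Finset.sum_congr rfl fun i _ => Finset.sum_congr rfl fun j _ => ?_
  rw [← h.apply i j]
  ring

theorem formE8Neg_isSymm : formE8Neg.IsSymm :=
  toBilin'_isSymm (by rw [Matrix.IsSymm, Matrix.transpose_neg, CartanMatrix.E₈_transpose])

theorem formU_isSymm : formU.IsSymm := toBilin'_isSymm (by decide)

theorem formCommon_isSymm : formCommon.IsSymm :=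
  orthSum_isSymm (orthSum_isSymm formE8Neg_isSymm formE8Neg_isSymm)
    (orthSum_isSymm formU_isSymm formU_isSymm)

theorem formGamma_isSymm : formGamma.IsSymm :=
  orthSum_isSymm formCommon_isSymm (toBilin'_isSymm (by decide))

theorem formGammaBar_isSymm : formGammaBar.IsSymm :=
  orthSum_isSymm formCommon_isSymm (toBilin'_isSymm (by decide))

theorem formMukai_isSymm : formMukai.IsSymm :=
  orthSum_isSymm formCommon_isSymm
    (orthSum_isSymm formU_isSymm (toBilin'_isSymm (by decide)))

theorem formU_apply (x y : Fin 2 → ℤ) : formU x y = x 0 * y 1 + x 1 * y 0 := by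
  simp [formU, Matrix.toBilin'_apply, Fin.sum_univ_two]

theorem formA2Neg_apply (x y : Fin 2 → ℤ) :
    formA2Neg x y = -2 * x 0 * y 0 + x 0 * y 1 + x 1 * y 0 - 2 * x 1 * y 1 := by
  simp [formA2Neg, Matrix.toBilin'_apply, Fin.sum_univ_two]
  ring

/-- An integral symmetric matrix with even diagonal defines an even form: off-diagonal terms occur
twice. -/
theorem even_toBilin' {n : Type*} [Fintype n] [DecidableEq n] {A : Matrix n n ℤ} (hA : A.IsSymm)
    (hd : ∀ i, Even (A i i)) (x : n → ℤ) : Even (Matrix.toBilin' A x x) := by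
  have hs := (toBilin'_isSymm hA).eq
  obtain ⟨c, rfl⟩ : ∃ c : n → ℤ, x = ∑ i, c i • Pi.single i 1 :=
    ⟨x, by ext j; simp [Finset.sum_apply, Pi.single_apply]⟩
  induction (Finset.univ : Finset (n)) using Finset.induction_on with
  | empty => simp
  | insert i s hi ih =>
    rw [Finset.sum_insert hi]
    set y := ∑ j ∈ s, c j • (Pi.single j 1 : n → ℤ)
    have h1 : Matrix.toBilin' A (c i • Pi.single i 1 + y) (c i • Pi.single i 1 + y) =
        c i * c i * A i i + 2 * Matrix.toBilin' A (c i • Pi.single i 1) y +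
          Matrix.toBilin' A y y := by
      have h2 : Matrix.toBilin' A (c i • Pi.single i 1) (c i • Pi.single i 1) =
          c i * c i * A i i := by
        simp only [map_smul, LinearMap.smul_apply, smul_eq_mul, Matrix.toBilin'_single]
        ring
      have h3 := hs y (c i • Pi.single i 1)
      simp only [map_add, LinearMap.add_apply, h2, h3]
      ring
    rw [h1]
    exact (((hd i).mul_left _).add (even_two_mul _)).add ih

theorem even_formE8Neg (x : Fin 8 → ℤ) : Even (formE8Neg x x) :=
  even_toBilin' (by rw [Matrix.IsSymm, Matrix.transpose_neg, CartanMatrix.E₈_transpose])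
    (fun i => by simp) x

theorem even_formGamma (x : Gamma) : Even (formGamma x x) := by
  obtain ⟨a, ha⟩ := even_formE8Neg x.1.1.1
  obtain ⟨b, hb⟩ := even_formE8Neg x.1.1.2
  simp only [formGamma, formCommon, orthSum_apply, ha, hb, formU_apply, formA2Neg_apply]
  exact ⟨a + b + x.1.2.1 0 * x.1.2.1 1 + x.1.2.2 0 * x.1.2.2 1 - x.2 0 * x.2 0 +
    x.2 0 * x.2 1 - x.2 1 * x.2 1, by ring⟩

/-- `E₈(-1)` is unimodular: a vector whose pairings are all divisible by `d` is divisible by `d`. -/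
theorem dvd_of_dvd_formE8Neg {d : ℤ} {x : Fin 8 → ℤ} (h : ∀ y, d ∣ formE8Neg x y) (i : Fin 8) :
    d ∣ x i := by
  have hdet : IsUnit (CartanMatrix.E₈).det := by simp [CartanMatrix.E₈_det]
  have h1 : ∀ j, d ∣ Matrix.vecMul x CartanMatrix.E₈ j := fun j => by
    have := h (-Pi.single j 1)
    simpa [formE8Neg, Matrix.toBilin'_apply', Matrix.dotProduct_mulVec] using this
  have h2 : x = Matrix.vecMul (Matrix.vecMul x CartanMatrix.E₈) CartanMatrix.E₈⁻¹ := by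
    rw [Matrix.vecMul_vecMul, Matrix.mul_nonsing_inv _ hdet, Matrix.vecMul_one]
  rw [h2, Matrix.vecMul, dotProduct]
  exact Finset.dvd_sum fun j _ => (h1 j).mul_right _

/-! ### The orbit relation -/

section Carries

variable {M : Type*} [AddCommGroup M]

/-- Some isometry of `(M, B)` fixing every element of `T` sends `x` to `y`. -/
def Carries (B : BilinForm ℤ M) (T : Set M) (x y : M) : Prop :=
  ∃ g : M ≃ₗ[ℤ] M, (∀ x y, B (g x) (g y) = B x y) ∧ (∀ t ∈ T, g t = t) ∧ g x = y

variable {B : BilinForm ℤ M} {T : Set M} {x y z : M}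

theorem Carries.refl (B : BilinForm ℤ M) (T : Set M) (x : M) : Carries B T x x :=
  ⟨LinearEquiv.refl ℤ M, fun _ _ => rfl, fun _ _ => rfl, rfl⟩

theorem Carries.symm (h : Carries B T x y) : Carries B T y x := by
  obtain ⟨g, h1, h2, rfl⟩ := h
  refine ⟨g.symm, fun x y => ?_, fun t ht => ?_, by simp⟩
  · rw [← h1, g.apply_symm_apply, g.apply_symm_apply]
  · rw [g.symm_apply_eq, h2 t ht]

theorem Carries.trans (h : Carries B T x y) (h' : Carries B T y z) : Carries B T x z := by
  obtain ⟨g, h1, h2, rfl⟩ := h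
  obtain ⟨g', h1', h2', rfl⟩ := h'
  exact ⟨g.trans g', fun x y => by simp [h1, h1'], fun t ht => by simp [h2 t ht, h2' t ht],
    by simp⟩

theorem Carries.neg (h : Carries B T x y) : Carries B T (-x) (-y) := by
  obtain ⟨g, h1, h2, rfl⟩ := h
  exact ⟨g, h1, h2, by simp⟩

theorem Carries.nonempty_isometryEquiv (h : Carries B T x y) :
    Nonempty ((B.restrict (saturation (Submodule.span ℤ (insert x T)))).IsometryEquiv
      (B.restrict (saturation (Submodule.span ℤ (insert y T))))) := by
  obtain ⟨g, h1, h2, rfl⟩ := h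
  refine exists_saturation_isometryEquiv g h1 ?_
  rw [Submodule.map_span, Set.image_insert_eq]
  congr 2
  exact (Set.image_congr h2).trans (Set.image_id' T)

end Carries

/-- `v` and `w` are related if an isometry of `Γ̄` fixing `h²` sends `v` to `w`, and so does an
isometry of `Λ̃` fixing `λ₁` and `λ₂`. -/
def OrbitRel (v w : Gamma) : Prop :=
  Carries formGammaBar {hSq} (toGammaBar v) (toGammaBar w) ∧
    Carries formMukai {lam1, lam2} (toMukai v) (toMukai w)

namespace OrbitRel

variable {u v w : Gamma}

theorem refl (v : Gamma) : OrbitRel v v := ⟨Carries.refl _ _ _, Carries.refl _ _ _⟩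

theorem symm (h : OrbitRel v w) : OrbitRel w v := ⟨h.1.symm, h.2.symm⟩

theorem trans (h : OrbitRel u v) (h' : OrbitRel v w) : OrbitRel u w :=
  ⟨h.1.trans h'.1, h.2.trans h'.2⟩

theorem neg (h : OrbitRel v w) : OrbitRel (-v) (-w) := by
  simpa only [OrbitRel, map_neg] using And.intro h.1.neg h.2.neg

theorem formGamma_eq (h : OrbitRel v w) : formGamma v v = formGamma w w := by
  obtain ⟨⟨g, h1, -, h3⟩, -⟩ := h
  rw [← toGammaBar_isometry, ← toGammaBar_isometry, ← h3, h1]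

theorem exists_act (h : OrbitRel v w) : ∃ g : OTilde, act g v = w := by
  obtain ⟨⟨g, h1, h2, h3⟩, -⟩ := h
  exact ⟨⟨g, h1, h2 _ rfl⟩, toGammaBar_injective (by rw [toGammaBar_act, h3])⟩

theorem nonempty_formK (h : OrbitRel v w) : Nonempty ((formK v).IsometryEquiv (formK w)) := by
  have := h.1.nonempty_isometryEquiv
  rwa [Set.pair_comm, Set.pair_comm (toGammaBar w)] at this

theorem nonempty_formL (h : OrbitRel v w) : Nonempty ((formL v).IsometryEquiv (formL w)) := by
  have := h.2.nonempty_isometryEquiv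
  rwa [Set.insert_comm, Set.pair_comm, Set.insert_comm (toMukai w),
    Set.pair_comm (toMukai w)] at this

theorem isPrimitiveVector (h : OrbitRel v w) (hv : IsPrimitiveVector v) :
    IsPrimitiveVector w := by
  obtain ⟨g, hg⟩ := h.symm.exists_act
  rintro n x rfl
  exact hv n (act g x) (by rw [← map_smul, hg])

theorem of_eichler {e a : Gamma} {q : ℤ} (he : formGamma e e = 0) (hea : formGamma e a = 0)
    (haa : formGamma a a = 2 * q) (v : Gamma) : OrbitRel v (eichler formGamma e a q v) := by
  have hbar : ∀ x, formGammaBar (toGammaBar x) hSq = 0 := fun x => by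
    rw [formGammaBar_isSymm.eq]
    exact (mem_range_toGammaBar _).1 ⟨x, rfl⟩
  have hmuk : ∀ x, ∀ t ∈ ({lam1, lam2} : Set Mukai), formMukai (toMukai x) t = 0 := by
    rintro x t (rfl | rfl) <;> rw [formMukai_isSymm.eq]
    · exact ((mem_range_toMukai _).1 ⟨x, rfl⟩).1
    · exact ((mem_range_toMukai _).1 ⟨x, rfl⟩).2
  constructor
  · have h1 : formGammaBar (toGammaBar e) (toGammaBar e) = 0 := by rw [toGammaBar_isometry, he]
    have h2 : formGammaBar (toGammaBar e) (toGammaBar a) = 0 := by rw [toGammaBar_isometry, hea]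
    have h3 : formGammaBar (toGammaBar a) (toGammaBar a) = 2 * q := by
      rw [toGammaBar_isometry, haa]
    refine ⟨eichlerEquiv formGammaBar_isSymm h1 h2 h3,
      eichler_isometry formGammaBar_isSymm h1 h2 h3, ?_, eichler_map toGammaBar toGammaBar_isometry e a q v⟩
    rintro t rfl
    exact eichler_fixed (hbar e) (hbar a)
  · have h1 : formMukai (toMukai e) (toMukai e) = 0 := by rw [toMukai_isometry, he]
    have h2 : formMukai (toMukai e) (toMukai a) = 0 := by rw [toMukai_isometry, hea]
    have h3 : formMukai (toMukai a) (toMukai a) = 2 * q := by rw [toMukai_isometry, haa]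
    exact ⟨eichlerEquiv formMukai_isSymm h1 h2 h3, eichler_isometry formMukai_isSymm h1 h2 h3,
      fun t ht => eichler_fixed (hmuk e t ht) (hmuk a t ht),
      eichler_map toMukai toMukai_isometry e a q v⟩

/-- Isometries of `E ⊕ U₁ ⊕ U₂` extend by the identity to both ambient lattices. -/
theorem of_common (σ : Common ≃ₗ[ℤ] Common)
    (hσ : ∀ x y, formCommon (σ x) (σ y) = formCommon x y) (v : Gamma) :
    OrbitRel v (σ v.1, v.2) := by
  constructor
  · refine ⟨σ.prodCongr (LinearEquiv.refl ℤ _), fun x y => ?_, ?_, ?_⟩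
    · simp [formGammaBar, hσ]
    · rintro t rfl
      simp [hSq]
    · simp [toGammaBar_apply]
  · refine ⟨σ.prodCongr (LinearEquiv.refl ℤ _), fun x y => ?_, ?_, ?_⟩
    · simp [formMukai, hσ]
    · rintro t (rfl | rfl)
      · simp [lam1]
      · simp [lam2]
    · simp [toMukai_apply]

/-- Interchanging `U₁` and `U₂`. -/
theorem swap (v : Gamma) : OrbitRel v ((v.1.1, (v.1.2.2, v.1.2.1)), v.2) := by
  refine of_common ((LinearEquiv.refl ℤ _).prodCongr (LinearEquiv.prodComm ℤ _ _))
    (fun x y => ?_) v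
  simp [formCommon, add_comm]

/-- Interchanging `e₁` and `f₁`. -/
theorem flip (v : Gamma) :
    OrbitRel v ((v.1.1, (v.1.2.1 ∘ Equiv.swap 0 1, v.1.2.2)), v.2) := by
  refine of_common ((LinearEquiv.refl ℤ _).prodCongr
    ((LinearEquiv.funCongrLeft ℤ ℤ (Equiv.swap 0 1)).prodCongr (LinearEquiv.refl ℤ _)))
    (fun x y => ?_) v
  simp [formCommon, formU_apply, LinearMap.funLeft_apply]
  ring

end OrbitRel

theorem K_neg (v : Gamma) : K (-v) = K v := by
  rw [K, K, map_neg, Submodule.span_insert, Submodule.span_insert, ← Set.neg_singleton,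
    Submodule.span_neg]

theorem L_neg (v : Gamma) : L (-v) = L v := by
  simp only [L, map_neg, Submodule.span_insert, ← Set.neg_singleton, Submodule.span_neg]

/-! ### Normal forms of primitive vectors -/

/-- The vector `γ e₂ + t f₂ + ρ`, with `ρ ∈ A₂(-1)`. -/
def normalForm (γ t : ℤ) (ρ : Fin 2 → ℤ) : Gamma := ((0, (0, ![γ, t])), ρ)

theorem formGamma_e2 (x : Gamma) : formGamma (normalForm 1 0 0) x = x.1.2.2 1 := by
  simp [normalForm, formGamma, formCommon, formU_apply]

theorem formGamma_f2 (x : Gamma) : formGamma (normalForm 0 1 0) x = x.1.2.2 0 := by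
  simp [normalForm, formGamma, formCommon, formU_apply]

/-- Each orbit meets the complement of `U₂`. In an element of the orbit whose `e₂`-coordinate `c`
is nonzero of least absolute value, the transvections attached to `f₂` reduce the `U₁`-coordinates
modulo `c`; by minimality they reduce to zero, and then `U₁` and `U₂` can be interchanged. -/
theorem exists_orbitRel_U2_eq_zero (v : Gamma) : ∃ w, OrbitRel v w ∧ w.1.2.2 = 0 := by
  classical
  by_cases hP : ∃ n : ℕ, n ≠ 0 ∧ ∃ w, OrbitRel v w ∧ (w.1.2.2 0).natAbs = n
  · obtain ⟨hn, w, hw, hwn⟩ := Nat.find_spec hP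
    set n := Nat.find hP
    have hmin : ∀ w', OrbitRel v w' → (w'.1.2.2 0).natAbs < n → w'.1.2.2 0 = 0 := by
      intro w' hw' hlt
      by_contra hne
      exact Nat.find_min hP hlt ⟨Int.natAbs_ne_zero.2 hne, w', hw', rfl⟩
    set c := w.1.2.2 0 with hc
    have hc0 : c ≠ 0 := by omega
    set k : Fin 2 → ℤ := fun i => w.1.2.1 i / c with hk
    let a : Gamma := ((0, (-k, 0)), 0)
    have hrel := hw.trans (OrbitRel.of_eichler (e := normalForm 0 1 0) (a := a) (q := k 0 * k 1)
      (by rw [formGamma_f2]; simp [normalForm]) (by simp [formGamma_f2, a])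
      (by simp [a, formGamma, formCommon, formU_apply]; ring) w)
    set w' := eichler formGamma (normalForm 0 1 0) a (k 0 * k 1) w with hw'
    have hr : ∀ i, w'.1.2.1 i = w.1.2.1 i % c := fun i => by
      rw [hw', eichler_apply, formGamma_f2, ← hc, Int.emod_def]
      simp [normalForm, a, hk]
      ring
    have hlt : ∀ i, (w'.1.2.1 i).natAbs < n := fun i => by
      have h1 := Int.emod_nonneg (w.1.2.1 i) hc0
      have h2 := Int.emod_lt_abs (w.1.2.1 i) hc0
      rw [hr]
      have h3 := Int.abs_eq_natAbs c
      omega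
    refine ⟨_, hrel.trans (OrbitRel.swap w'), ?_⟩
    have h0 := hmin _ (hrel.trans (OrbitRel.swap w')) (hlt 0)
    have h1 := hmin _ ((hrel.trans (OrbitRel.flip w')).trans (OrbitRel.swap _))
      (by simpa using hlt 1)
    ext i
    fin_cases i
    · exact h0
    · simpa using h1
  · push Not at hP
    have h0 : ∀ w, OrbitRel v w → w.1.2.2 0 = 0 := fun w hw => by
      by_contra hne
      exact hP _ (Int.natAbs_ne_zero.2 hne) w hw rfl
    refine ⟨v, OrbitRel.refl v, ?_⟩
    ext i
    fin_cases i
    · exact h0 v (OrbitRel.refl v)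
    · simpa using h0 _ (((OrbitRel.swap v).trans (OrbitRel.flip _)).trans (OrbitRel.swap _))

/-- Eichler's criterion: if `w = γb + ρ` is orthogonal to `U₂` and pairs to `-γ` with some vector,
a transvection attached to `e₂` adds `γ e₂` to `w`, and one attached to `f₂` then removes `γb`. -/
theorem orbitRel_normalForm {γ : ℤ} {ρ : Fin 2 → ℤ} {a b w : Gamma} (hb : b.1.2.2 = 0)
    (hw : w = γ • b + normalForm 0 0 ρ) (ha : formGamma a w = -γ) :
    ∃ q, OrbitRel w (normalForm γ (γ * q + formA2Neg b.2 ρ) ρ) := by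
  have hw2 : w.1.2.2 = 0 := by simp [hw, hb, normalForm]
  let a' : Gamma := ((a.1.1, (a.1.2.1, 0)), a.2)
  have ha' : formGamma a' w = -γ := by
    rw [← ha]
    simp [a', formGamma, formCommon, formU_apply, hw2]
  obtain ⟨p, hp⟩ := (even_formGamma a').two_dvd
  obtain ⟨q, hq⟩ := (even_formGamma b).two_dvd
  have h1 := OrbitRel.of_eichler (e := normalForm 1 0 0) (a := a') (q := p)
    (by rw [formGamma_e2]; simp [normalForm]) (by simp [formGamma_e2, a']) hp w
  have h2 : eichler formGamma (normalForm 1 0 0) a' p w = w + normalForm γ 0 0 := by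
    rw [eichler_apply, formGamma_e2, ha', hw2]
    ext i <;> simp [normalForm]
    fin_cases i <;> simp
  rw [h2] at h1
  have h3 := OrbitRel.of_eichler (e := normalForm 0 1 0) (a := -b) (q := q)
    (by rw [formGamma_f2]; simp [normalForm]) (by simp [formGamma_f2, hb]) (by simpa using hq)
    (w + normalForm γ 0 0)
  have h4 : formGamma b (w + normalForm γ 0 0) = 2 * γ * q + formA2Neg b.2 ρ := by
    rw [hw, map_add, map_add, map_smul, hq]
    simp [normalForm, formGamma, formCommon, formU_apply, hb]
    ring
  have h5 : eichler formGamma (normalForm 0 1 0) (-b) q (w + normalForm γ 0 0) =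
      normalForm γ (γ * q + formA2Neg b.2 ρ) ρ := by
    rw [eichler_apply, formGamma_f2, map_neg, LinearMap.neg_apply, h4]
    have h6 : (w + normalForm γ 0 0).1.2.2 0 = γ := by simp [hw2, normalForm]
    rw [h6, hw]
    ext i
    · simp [normalForm]
    · simp [normalForm]
    · simp [normalForm]
    · fin_cases i <;> simp [normalForm, hb]
      ring
    · simp [normalForm]
  exact ⟨q, h5 ▸ h1.trans h3⟩

/-- As `E ⊕ U₁ ⊕ U₂` is unimodular, the component there of a vector whose pairings are all divisible
by `d` is divisible by `d`. -/
theorem exists_fst_eq_smul {w : Gamma} {d : ℤ} (h : ∀ x, d ∣ formGamma w x) :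
    ∃ x : Common, w.1 = d • x := by
  have hp : ∀ i, d ∣ w.1.1.1 i := dvd_of_dvd_formE8Neg fun y => by
    simpa [formGamma, formCommon] using h (((y, 0), 0), 0)
  have hq : ∀ i, d ∣ w.1.1.2 i := dvd_of_dvd_formE8Neg fun y => by
    simpa [formGamma, formCommon] using h (((0, y), 0), 0)
  have hr : ∀ i, d ∣ w.1.2.1 i := fun i => by
    fin_cases i
    · simpa [formGamma, formCommon, formU_apply] using h ((0, (![0, 1], 0)), 0)
    · simpa [formGamma, formCommon, formU_apply] using h ((0, (![1, 0], 0)), 0)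
  have hs : ∀ i, d ∣ w.1.2.2 i := fun i => by
    fin_cases i
    · simpa [formGamma, formCommon, formU_apply] using h ((0, (0, ![0, 1])), 0)
    · simpa [formGamma, formCommon, formU_apply] using h ((0, (0, ![1, 0])), 0)
  choose p hp using hp
  choose q hq using hq
  choose r hr using hr
  choose s hs using hs
  exact ⟨((p, q), (r, s)), Prod.ext (Prod.ext (funext hp) (funext hq))
    (Prod.ext (funext hr) (funext hs))⟩

/-- The pairings of a primitive vector with `Γ` generate `ℤ` or `3ℤ`, since `3` annihilates the
discriminant group of `Γ`. -/
theorem divisibility {w : Gamma} (hw : IsPrimitiveVector w) :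
    ∃ γ : ℤ, (γ = 1 ∨ γ = 3) ∧ (∀ x, γ ∣ formGamma w x) ∧ ∃ a, formGamma a w = -γ := by
  obtain ⟨d, hd⟩ := IsPrincipalIdealRing.principal (LinearMap.range (formGamma w))
  have hdvd : ∀ x, d ∣ formGamma w x := fun x => by
    have h : formGamma w x ∈ LinearMap.range (formGamma w) := ⟨x, rfl⟩
    rw [hd] at h
    exact Ideal.mem_span_singleton.1 h
  obtain ⟨a, ha⟩ : d ∈ LinearMap.range (formGamma w) := by
    rw [hd]
    exact Submodule.mem_span_singleton_self d
  have h3 : ∃ u : Gamma, (3 : ℤ) • w = d • u := by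
    obtain ⟨x, hx⟩ := exists_fst_eq_smul hdvd
    -- `-2μ₁ - μ₂` and `-μ₁ - 2μ₂` pair with `x` to `3x₀` and `3x₁`.
    have hz0 : d ∣ 3 * w.2 0 := by
      have := hdvd (0, ![-2, -1])
      simp [formGamma, formCommon, formA2Neg_apply] at this
      convert this using 1
      ring
    have hz1 : d ∣ 3 * w.2 1 := by
      have := hdvd (0, ![-1, -2])
      simp [formGamma, formCommon, formA2Neg_apply] at this
      convert this using 1
      ring
    obtain ⟨z0, hz0⟩ := hz0
    obtain ⟨z1, hz1⟩ := hz1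
    refine ⟨((3 : ℤ) • x, ![z0, z1]), Prod.ext ?_ ?_⟩
    · rw [Prod.smul_fst, hx, smul_comm]
      rfl
    · ext i
      fin_cases i <;> simp [hz0, hz1]
  obtain ⟨u, hu⟩ := h3
  -- It remains to see that `d` is `±1` or `±3`.
  have hd13 : d.natAbs = 1 ∨ d.natAbs = 3 := by
    by_cases h3d : (3 : ℤ) ∣ d
    · obtain ⟨k, rfl⟩ := h3d
      have : w = k • u := by
        rw [mul_smul] at hu
        exact zsmul_right_injective (three_ne_zero : (3 : ℤ) ≠ 0) hu
      have := Int.isUnit_iff_natAbs_eq.1 (hw k u this)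
      omega
    · have hcop : IsCoprime (3 : ℤ) d := (Int.prime_three.coprime_iff_not_dvd).2 h3d
      obtain ⟨x, y, hxy⟩ := hcop
      have : w = d • (x • u + y • w) := by
        calc w = (x * 3 + y * d) • w := by rw [hxy, one_smul]
          _ = x • (3 : ℤ) • w + y • d • w := by rw [add_smul, mul_smul, mul_smul]
          _ = d • (x • u + y • w) := by rw [hu]; module
      exact Or.inl (Int.isUnit_iff_natAbs_eq.1 (hw d _ this))
  refine ⟨d.natAbs, by omega, fun x => Int.natAbs_dvd.2 (hdvd x), ?_⟩
  rcases Int.natAbs_eq d with h | h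
  · exact ⟨-a, by rw [map_neg, LinearMap.neg_apply, formGamma_isSymm.eq, ha, ← h]⟩
  · exact ⟨a, by rw [formGamma_isSymm.eq, ha]; omega⟩

/-- Up to sign, a primitive vector is related to `e₂ + t f₂` or to `3e₂ + 3s f₂ + μ₁ - μ₂`. -/
theorem exists_normalForm {v : Gamma} (hv : IsPrimitiveVector v) :
    ∃ w, (w = v ∨ w = -v) ∧ ((∃ t, OrbitRel w (normalForm 1 t 0)) ∨
      ∃ s, OrbitRel w (normalForm 3 (3 * s) ![1, -1])) := by
  obtain ⟨w, hvw, hw2⟩ := exists_orbitRel_U2_eq_zero v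
  have hw := hvw.isPrimitiveVector hv
  obtain ⟨γ, rfl | rfl, hdvd, a, ha⟩ := divisibility hw
  · obtain ⟨q, hq⟩ := orbitRel_normalForm (ρ := 0) hw2
      (by ext i <;> simp [normalForm]; fin_cases i <;> simp) ha
    exact ⟨v, Or.inl rfl, Or.inl ⟨_, hvw.trans hq⟩⟩
  · obtain ⟨x, hx⟩ := exists_fst_eq_smul hdvd
    have hx2 : x.2.2 = 0 := by
      rw [hx, Prod.smul_snd, Prod.smul_snd] at hw2
      exact (smul_eq_zero.1 hw2).resolve_left three_ne_zero
    have hz : 3 ∣ w.2 0 + w.2 1 := by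
      have := hdvd (0, ![1, 0])
      simp [formGamma, formCommon, formA2Neg_apply] at this
      omega
    -- If `w` is `ε(μ₁ - μ₂)` modulo `3`, the criterion applies to `εw`.
    have key : ∀ ε : ℤ, (ε = 1 ∨ ε = -1) → 3 ∣ ε * w.2 0 - 1 →
        ∃ s, OrbitRel (ε • w) (normalForm 3 (3 * s) ![1, -1]) := by
      intro ε hε h0
      have h1 : 3 ∣ ε * w.2 1 + 1 := by rcases hε with rfl | rfl <;> omega
      obtain ⟨z0, hz0⟩ := h0
      obtain ⟨z1, hz1⟩ := h1
      have hεw : ε • w = (3 : ℤ) • (ε • x, ![z0, z1]) + normalForm 0 0 ![1, -1] := by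
        refine Prod.ext ?_ ?_
        · have h00 : (![0, 0] : Fin 2 → ℤ) = 0 := by simp
          rw [Prod.smul_fst, hx, smul_comm]
          simp [normalForm, h00]
        · ext i
          fin_cases i <;> simp [normalForm] <;> linarith
      obtain ⟨m, hm⟩ := orbitRel_normalForm (a := ε • a) (by simp [hx2]) hεw (by
        rw [map_smul, map_smul, LinearMap.smul_apply, ha]
        rcases hε with rfl | rfl <;> simp)
      refine ⟨m + z1 - z0, ?_⟩
      convert hm using 2
      simp [formA2Neg_apply]
      ring
    have h0 : ¬ 3 ∣ w.2 0 := by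
      intro h0
      have h1 : 3 ∣ w.2 1 := by omega
      obtain ⟨z0, hz0⟩ := h0
      obtain ⟨z1, hz1⟩ := h1
      have hdiv : w = (3 : ℤ) • (x, ![z0, z1]) := by
        refine Prod.ext hx ?_
        ext i
        fin_cases i <;> simp [hz0, hz1]
      have := Int.isUnit_iff_natAbs_eq.1 (hw _ _ hdiv)
      omega
    rcases (by omega : 3 ∣ w.2 0 - 1 ∨ 3 ∣ -w.2 0 - 1) with h | h
    · obtain ⟨s, hs⟩ := key 1 (Or.inl rfl) (by simpa using h)
      exact ⟨v, Or.inl rfl, Or.inr ⟨s, hvw.trans (by simpa using hs)⟩⟩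
    · obtain ⟨s, hs⟩ := key (-1) (Or.inr rfl) (by simpa using h)
      exact ⟨-v, Or.inr rfl, Or.inr ⟨s, hvw.neg.trans (by simpa using hs)⟩⟩

/-! ### Discriminants of the normal forms -/

/-- If `v = γ w + ε h²` with `w = e₂ + s f₂ + (0, -ε, 0)`, then `h², w` is a basis of `K_v`: the
third coordinate on `I_{0,3}` and the `e₂`-coordinate are dual to it. -/
theorem disc_formK_of_basis {v : Gamma} {γ s ε : ℤ} (hγ : γ ≠ 0)
    (h : toGammaBar v = γ • ((0, (0, ![1, s])), ![0, -ε, 0]) + ε • hSq) :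
    disc (formK v) = (-6 * s + 2 * ε ^ 2).natAbs := by
  let w : GammaBar := ((0, (0, ![1, s])), ![0, -ε, 0])
  let f : GammaBar →ₗ[ℤ] Fin 2 → ℤ := LinearMap.pi ![
    LinearMap.proj 2 ∘ₗ LinearMap.snd ℤ Common (Fin 3 → ℤ),
    LinearMap.proj 0 ∘ₗ LinearMap.snd ℤ _ _ ∘ₗ LinearMap.snd ℤ _ _ ∘ₗ LinearMap.fst ℤ _ _]
  have hf : ∀ y, f y = ![y.2 2, y.1.2.2 0] := fun y => by
    ext i
    fin_cases i <;> rfl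
  have hmem : ∀ x ∈ ({hSq, toGammaBar v} : Set GammaBar), x ∈ K v := fun x hx =>
    ⟨1, one_ne_zero, by simpa using Submodule.subset_span hx⟩
  rw [formK, K, disc_saturation formGammaBar _ ![hSq, w] f]
  · have hww : formGammaBar w w = 2 * s - ε ^ 2 := by
      simp [w, formGammaBar, formCommon, formU_apply, formI03, Matrix.toBilin'_apply,
        Fin.sum_univ_three]
      ring
    have hhw : formGammaBar hSq w = ε := by simp [formGammaBar_hSq, w]
    have hhh : formGammaBar hSq hSq = -3 := by rw [formGammaBar_hSq]; simp [hSq]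
    rw [Matrix.det_fin_two]
    simp only [Matrix.of_apply, Matrix.cons_val_zero, Matrix.cons_val_one, hww, hhw, hhh,
      formGammaBar_isSymm.eq w hSq]
    congr 1
    ring
  · intro i
    ext j
    rw [hf]
    fin_cases i <;> fin_cases j <;> simp [hSq, w]
  · intro i
    fin_cases i
    · exact hmem _ (by simp)
    · refine ⟨γ, hγ, ?_⟩
      have : γ • w = toGammaBar v - ε • hSq := by rw [h, add_sub_cancel_right]
      change γ • w ∈ _
      rw [this]
      exact Submodule.sub_mem _ (Submodule.subset_span (by simp))
        (Submodule.smul_mem _ _ (Submodule.subset_span (by simp)))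
  · rw [Submodule.span_le]
    rintro x (rfl | rfl)
    · exact Submodule.subset_span ⟨0, rfl⟩
    · rw [h]
      exact Submodule.add_mem _ (Submodule.smul_mem _ _ (Submodule.subset_span ⟨1, rfl⟩))
        (Submodule.smul_mem _ _ (Submodule.subset_span ⟨0, rfl⟩))

/-- If `v = γ w + ε (λ₁ - λ₂)` with `w = e₂ + s f₂ + ε (e₃ + f₄)`, then `λ₁, λ₂, w` is a basis of
`L_v`: the coordinates at `e₄`, `f₃` and `e₂` are dual to it. -/
theorem disc_formL_of_basis {v : Gamma} {γ s ε : ℤ} (hγ : γ ≠ 0)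
    (h : toMukai v = γ • ((0, (0, ![1, s])), (![ε, 0], ![0, ε])) + ε • (lam1 - lam2)) :
    disc (formL v) = (-6 * s + 2 * ε ^ 2).natAbs := by
  let w : Mukai := ((0, (0, ![1, s])), (![ε, 0], ![0, ε]))
  let f : Mukai →ₗ[ℤ] Fin 3 → ℤ := LinearMap.pi ![
    LinearMap.proj 0 ∘ₗ LinearMap.snd ℤ _ _ ∘ₗ LinearMap.snd ℤ _ _,
    LinearMap.proj 1 ∘ₗ LinearMap.fst ℤ _ _ ∘ₗ LinearMap.snd ℤ _ _,
    LinearMap.proj 0 ∘ₗ LinearMap.snd ℤ _ _ ∘ₗ LinearMap.snd ℤ _ _ ∘ₗ LinearMap.fst ℤ _ _]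
  have hf : ∀ y, f y = ![y.2.2 0, y.2.1 1, y.1.2.2 0] := fun y => by
    ext i
    fin_cases i <;> rfl
  have hmem : ∀ x ∈ ({lam1, lam2, toMukai v} : Set Mukai), x ∈ L v := fun x hx =>
    ⟨1, one_ne_zero, by simpa using Submodule.subset_span hx⟩
  rw [formL, L, disc_saturation formMukai _ ![lam1, lam2, w] f]
  · rw [Matrix.det_fin_three]
    simp [formMukai, formCommon, formU_apply, formU4, Matrix.toBilin'_apply,
      Fin.sum_univ_two, lam1, lam2, w]
    rw [← Int.natAbs_neg]
    congr 1
    ring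
  · intro i
    ext j
    rw [hf]
    fin_cases i <;> fin_cases j <;> simp [lam1, lam2, w]
  · intro i
    fin_cases i
    · exact hmem _ (by simp)
    · exact hmem _ (by simp)
    · refine ⟨γ, hγ, ?_⟩
      have : γ • w = toMukai v - ε • (lam1 - lam2) := by rw [h, add_sub_cancel_right]
      change γ • w ∈ _
      rw [this]
      exact Submodule.sub_mem _ (Submodule.subset_span (by simp))
        (Submodule.smul_mem _ _ (Submodule.sub_mem _ (Submodule.subset_span (by simp))
          (Submodule.subset_span (by simp))))
  · rw [Submodule.span_le]
    rintro x (rfl | rfl | rfl)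
    · exact Submodule.subset_span ⟨0, rfl⟩
    · exact Submodule.subset_span ⟨1, rfl⟩
    · rw [h]
      exact Submodule.add_mem _ (Submodule.smul_mem _ _ (Submodule.subset_span ⟨2, rfl⟩))
        (Submodule.smul_mem _ _ (Submodule.sub_mem _ (Submodule.subset_span ⟨0, rfl⟩)
          (Submodule.subset_span ⟨1, rfl⟩)))

theorem disc_formK_normalForm_one (t : ℤ) :
    disc (formK (normalForm 1 t 0)) = (6 * t).natAbs := by
  rw [disc_formK_of_basis (γ := 1) (s := t) (ε := 0) one_ne_zero, ← Int.natAbs_neg]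
  · congr 1
    ring
  · rw [toGammaBar_apply]
    simp [normalForm]

theorem disc_formL_normalForm_one (t : ℤ) :
    disc (formL (normalForm 1 t 0)) = (6 * t).natAbs := by
  rw [disc_formL_of_basis (γ := 1) (s := t) (ε := 0) one_ne_zero, ← Int.natAbs_neg]
  · congr 1
    ring
  · rw [toMukai_apply]
    simp [normalForm]

theorem disc_formK_normalForm_three (s : ℤ) :
    disc (formK (normalForm 3 (3 * s) ![1, -1])) = (6 * s - 2).natAbs := by
  rw [disc_formK_of_basis (γ := 3) (s := s) (ε := 1) three_ne_zero, ← Int.natAbs_neg]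
  · congr 1
    ring
  · rw [toGammaBar_apply]
    simp [normalForm, hSq]

theorem disc_formL_normalForm_three (s : ℤ) :
    disc (formL (normalForm 3 (3 * s) ![1, -1])) = (6 * s - 2).natAbs := by
  rw [disc_formL_of_basis (γ := 3) (s := s) (ε := 1) three_ne_zero, ← Int.natAbs_neg]
  · congr 1
    ring
  · rw [toMukai_apply]
    simp [normalForm, lam1, lam2]

theorem formGamma_normalForm (γ t : ℤ) (ρ : Fin 2 → ℤ) :
    formGamma (normalForm γ t ρ) (normalForm γ t ρ) = 2 * γ * t + formA2Neg ρ ρ := by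
  simp [normalForm, formGamma, formCommon, formU_apply]
  ring

theorem nonempty_formK_neg (v : Gamma) : Nonempty ((formK (-v)).IsometryEquiv (formK v)) := by
  rw [formK, K_neg]
  exact ⟨.refl _⟩

theorem nonempty_formL_neg (v : Gamma) : Nonempty ((formL (-v)).IsometryEquiv (formL v)) := by
  rw [formL, L_neg]
  exact ⟨.refl _⟩

/-- The square and both discriminants of a primitive vector, read off from its normal form. -/
theorem exists_invariants {v : Gamma} (hv : IsPrimitiveVector v) :
    ∃ w, (w = v ∨ w = -v) ∧
      ((∃ t, OrbitRel w (normalForm 1 t 0) ∧ formGamma v v = 2 * t ∧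
        disc (formL v) = (6 * t).natAbs ∧ disc (formK v) = (6 * t).natAbs) ∨
      ∃ s, OrbitRel w (normalForm 3 (3 * s) ![1, -1]) ∧ formGamma v v = 18 * s - 6 ∧
        disc (formL v) = (6 * s - 2).natAbs ∧ disc (formK v) = (6 * s - 2).natAbs) := by
  obtain ⟨w, hw, h⟩ := exists_normalForm hv
  have hsq : formGamma v v = formGamma w w := by rcases hw with rfl | rfl <;> simp
  have hL : disc (formL v) = disc (formL w) := by
    rcases hw with rfl | rfl
    · rfl
    · exact (disc_eq_of_isometryEquiv (nonempty_formL_neg v).some).symm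
  have hK : disc (formK v) = disc (formK w) := by
    rcases hw with rfl | rfl
    · rfl
    · exact (disc_eq_of_isometryEquiv (nonempty_formK_neg v).some).symm
  refine ⟨w, hw, ?_⟩
  rcases h with ⟨t, h⟩ | ⟨s, h⟩
  · refine Or.inl ⟨t, h, ?_, ?_, ?_⟩
    · rw [hsq, h.formGamma_eq, formGamma_normalForm]
      simp
    · exact hL.trans
        ((disc_eq_of_isometryEquiv h.nonempty_formL.some).trans (disc_formL_normalForm_one _))
    · exact hK.trans
        ((disc_eq_of_isometryEquiv h.nonempty_formK.some).trans (disc_formK_normalForm_one _))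
  · refine Or.inr ⟨s, h, ?_, ?_, ?_⟩
    · rw [hsq, h.formGamma_eq, formGamma_normalForm, formA2Neg_apply]
      simp
      ring
    · exact hL.trans
        ((disc_eq_of_isometryEquiv h.nonempty_formL.some).trans (disc_formL_normalForm_three _))
    · exact hK.trans
        ((disc_eq_of_isometryEquiv h.nonempty_formK.some).trans (disc_formK_normalForm_three _))

theorem disc_formL_eq_disc_formK {v : Gamma} (hv : IsPrimitiveVector v) :
    disc (formL v) = disc (formK v) := by
  obtain ⟨w, -, ⟨t, -, -, h1, h2⟩ | ⟨s, -, -, h1, h2⟩⟩ := exists_invariants hv <;> rw [h1, h2]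

/-- Primitive vectors of equal discriminant and equal sign lie in one orbit up to sign: `6t` and
`6s - 2` differ modulo `6` also up to sign, so the normal forms are of the same type. -/
theorem exists_orbitRel_or_neg {v v' : Gamma} (hv : IsPrimitiveVector v)
    (hv' : IsPrimitiveVector v') (hd : disc (formL v) = disc (formL v'))
    (hs : formGamma v v < 0 ↔ formGamma v' v' < 0) : OrbitRel v v' ∨ OrbitRel v (-v') := by
  have hsign : ∀ w w', (w = v ∨ w = -v) → (w' = v' ∨ w' = -v') → OrbitRel w w' →
      OrbitRel v v' ∨ OrbitRel v (-v') := by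
    rintro w w' (rfl | rfl) (rfl | rfl) h
    · exact Or.inl h
    · exact Or.inr h
    · exact Or.inr (by simpa using h.neg)
    · exact Or.inl (by simpa using h.neg)
  obtain ⟨w, hw, ⟨t, h, hsq, hL, -⟩ | ⟨t, h, hsq, hL, -⟩⟩ := exists_invariants hv <;>
  obtain ⟨w', hw', ⟨t', h', hsq', hL', -⟩ | ⟨t', h', hsq', hL', -⟩⟩ := exists_invariants hv'
  · obtain rfl : t = t' := by omega
    exact hsign w w' hw hw' (h.trans h'.symm)
  · omega
  · omega
  · obtain rfl : t = t' := by omega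
    exact hsign w w' hw hw' (h.trans h'.symm)

end CubicLattice

theorem mainTheorem9 (v v' : CubicLattice.Gamma)
    (hv : CubicLattice.IsPrimitiveVector v) (hv' : CubicLattice.IsPrimitiveVector v') :
    (CubicLattice.disc (CubicLattice.formL v) = CubicLattice.disc (CubicLattice.formL v') ↔
      CubicLattice.disc (CubicLattice.formK v) = CubicLattice.disc (CubicLattice.formK v')) ∧
    (CubicLattice.disc (CubicLattice.formL v) = CubicLattice.disc (CubicLattice.formL v') →
      (CubicLattice.formGamma v v < 0 ↔ CubicLattice.formGamma v' v' < 0) →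
      (∃ g : CubicLattice.OTilde,
        (CubicLattice.act g v = v' ∨ CubicLattice.act g v = -v') ∧
        Nonempty ((CubicLattice.formL v').IsometryEquiv
          (CubicLattice.formL (CubicLattice.act g v))) ∧
        Nonempty ((CubicLattice.formK v').IsometryEquiv
          (CubicLattice.formK (CubicLattice.act g v)))) ∧
      Nonempty ((CubicLattice.formL v).IsometryEquiv (CubicLattice.formL v')) ∧
      Nonempty ((CubicLattice.formK v).IsometryEquiv (CubicLattice.formK v'))) := by
  refine ⟨by rw [CubicLattice.disc_formL_eq_disc_formK hv,
    CubicLattice.disc_formL_eq_disc_formK hv'], fun hd hs => ?_⟩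
  have hLneg := CubicLattice.nonempty_formL_neg v'
  have hKneg := CubicLattice.nonempty_formK_neg v'
  rcases CubicLattice.exists_orbitRel_or_neg hv hv' hd hs with h | h <;>
    obtain ⟨g, hg⟩ := h.exists_act
  · exact ⟨⟨g, Or.inl hg, by rw [hg]; exact ⟨⟨.refl _⟩, ⟨.refl _⟩⟩⟩, h.nonempty_formL,
      h.nonempty_formK⟩
  · exact ⟨⟨g, Or.inr hg, by rw [hg]; exact ⟨hLneg.map .symm, hKneg.map .symm⟩⟩,
      h.nonempty_formL.map2 .trans hLneg, h.nonempty_formK.map2 .trans hKneg⟩
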